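/- Let $\Sigma$ be a closed surface, i.e. a (non-empty) compact connected smooth surface without boundary, let $\Phi\colon\Sigma\to\mathbb R^3$ be a smooth immersion oriented by a smooth unit normal field $\nu$ along $\Phi$, and let $H$ be its mean curvature, i.e. the sum of the principal curvatures with respect to $\nu$ (so a sphere of radius $r$ has $H=2/r$ for the inward normal). For $\alpha\in\mathbb R$, call $(\Sigma,\Phi,\nu)$ $\alpha$-stationary if $\Phi$ avoids the origin and $$H(p)=\alpha\,\frac{\langle\nu(p),\Phi(p)\rangle}{|\Phi(p)|^2}\qquad\text{for all } p\in\Sigma .$$ Theorem. Spheres centred at the origin are the only closed $\alpha$-stationary surfaces, and they occur only for $\alpha=-2$. That is, for every $\alpha\in\mathbb R$: 1. $(\Sigma,\Phi,\nu)$ is $\alpha$-stationary if and only if $\alpha=-2$ and $\Phi$ is injective with image a round sphere $\{x\in\mathbb R^3:|x|=r\}$ for some $r>0$. In particular there are no closed $\alpha$-stationary surfaces for $\alpha>-2$ or for $\alpha<-2$, and no stability is assumed for $\alpha=-2$. 2. For every $r>0$, the sphere of radius $r$ centred at the origin, i.e. the immersion $p\mapsto rp$ of the unit sphere with the inward unit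 normal $\nu(p)=-p$, is such an oriented immersed surface, and it is $\alpha$-stationary if and only if $\alpha=-2$. -/

import Mathlib

open scoped Manifold ContDiff

noncomputable section

/-- Euclidean three-space. -/
abbrev E3 : Type := EuclideanSpace ℝ (Fin 3)

section Surfaces

variable {M : Type*} [TopologicalSpace M] [ChartedSpace (EuclideanSpace ℝ (Fin 2)) M]

/-- `Φ : M → ℝ³` is a smooth immersion of the surface `M`, and `ν` is a smooth unit normal field
along `Φ`, that is, a Gauss map (the choice of `ν` is the orientation of the surface). -/
structure IsOrientedImmersion (Φ ν : M → E3) : Prop where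
  smooth : ContMDiff (𝓡 2) 𝓘(ℝ, E3) ∞ Φ
  immersion : ∀ x : M, Function.Injective (mfderiv (𝓡 2) 𝓘(ℝ, E3) Φ x)
  smooth_normal : ContMDiff (𝓡 2) 𝓘(ℝ, E3) ∞ ν
  norm_normal : ∀ x : M, ‖ν x‖ = 1
  orthogonal : ∀ (x : M) (v : TangentSpace (𝓡 2) x),
    inner ℝ (ν x) (mfderiv (𝓡 2) 𝓘(ℝ, E3) Φ x v : E3) = 0

/-- The derivative at `x` of a map `F : M → ℝ³` along the `i`-th vector of the standard basis of
the tangent space `T_x M = ℝ²`. -/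
def partialDeriv (F : M → E3) (x : M) (i : Fin 2) : E3 :=
  mfderiv (𝓡 2) 𝓘(ℝ, E3) F x (EuclideanSpace.single i 1 : EuclideanSpace ℝ (Fin 2))

/-- The matrix of the first fundamental form, `g i j = ⟨∂ᵢ Φ, ∂ⱼ Φ⟩`. -/
def firstFundamentalForm (Φ : M → E3) (x : M) : Matrix (Fin 2) (Fin 2) ℝ :=
  Matrix.of fun i j => inner ℝ (partialDeriv Φ x i) (partialDeriv Φ x j)

/-- The matrix of the second fundamental form, `h i j = - ⟨∂ᵢ ν, ∂ⱼ Φ⟩` (which is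
`⟨ν, ∂ᵢ ∂ⱼ Φ⟩` in coordinates). -/
def secondFundamentalForm (Φ ν : M → E3) (x : M) : Matrix (Fin 2) (Fin 2) ℝ :=
  Matrix.of fun i j => -inner ℝ (partialDeriv ν x i) (partialDeriv Φ x j)

/-- The mean curvature: the sum of the principal curvatures, that is, the trace of the shape
operator `g⁻¹ h`. A sphere of radius `r` has mean curvature `2 / r` for the inward normal. -/
def meanCurvature (Φ ν : M → E3) (x : M) : ℝ :=
  ((firstFundamentalForm Φ x)⁻¹ * secondFundamentalForm Φ ν x).trace

/-- The surface avoids the origin and satisfies `H(p) = α ⟨ν(p), p⟩ / |p|²` at all its points. -/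
structure IsAlphaStationary (α : ℝ) (Φ ν : M → E3) : Prop where
  ne_zero : ∀ x : M, Φ x ≠ 0
  eq : ∀ x : M, meanCurvature Φ ν x = α * inner ℝ (ν x) (Φ x) / ‖Φ x‖ ^ 2

end Surfaces

/-- The standard parametrization, by the unit sphere, of the sphere of radius `r` centred at the
origin. -/
def roundSphere (r : ℝ) (p : Metric.sphere (0 : E3) 1) : E3 := r • (p : E3)

/-- The inward unit normal of `roundSphere r`, for `r > 0`. -/
def roundSphereNormal (p : Metric.sphere (0 : E3) 1) : E3 := -(p : E3)

end

/-!
Take an ambient function `u` restricted to an oriented immersed surface. At a critical point of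
`u ∘ Φ` the Laplacian of `u ∘ Φ` is the trace of the Hessian of `u` over the tangent plane plus `H`
times the normal derivative of `u`, and this number is nonpositive at a local maximum
(`IsOrientedImmersion.second_order_of_isLocalMax`).

For `u = |p|²` half of it is `2 + H ⟨ν, Φ⟩`. At a point where `|Φ|` is extremal, `Φ` is normal, so
the stationarity equation gives `H ⟨ν, Φ⟩ = α`. A maximum of `|Φ|` on a closed surface then forces
`α ≤ -2`, and a minimum forces `α ≥ -2` (`IsAlphaStationary.eq_neg_two`).

For `α = -2` one has `2 + H ⟨ν, Φ⟩ = 2 (1 - ⟨ν, Φ⟩² / |Φ|²) ≥ 0` everywhere, so `|Φ|²` is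
subharmonic and the strong maximum principle makes it constant
(`IsAlphaStationary.exists_norm_eq`). The principle is proved by Hopf's argument
(`IsOrientedImmersion.eventually_norm_sq_eq`). Its barrier is the restriction of an ambient
Gaussian, for which only the second-order test above is needed, not the Laplacian in coordinates.

An immersion of a closed surface into a sphere is a local homeomorphism by the inverse function
theorem, hence a covering map. Lifting the two planes of stereographic projection from two points
gives two local sections, which agree on the connected complement of the two points. They form a
global section with open and closed image, so the immersion is bijective onto the sphere
(`IsLocalHomeomorph.bijective_of_sphere`).

Conversely, if `|Φ|` is constant, every point is both a maximum and a minimum of `|Φ|²`, so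
`H ⟨ν, Φ⟩ = -2` and `Φ` is normal, which is the equation for `α = -2` and for no other `α`
(`IsOrientedImmersion.isAlphaStationary_iff_of_norm_eq`).
-/

section

open scoped Matrix
open Filter Topology Set

/-! ### Calculus of maps of the plane -/

/-- The second-derivative test at an interior maximum. -/
theorem IsLocalMax.deriv_deriv_nonpos {w : ℝ → ℝ} {a : ℝ} (h : IsLocalMax w a)
    (hc : ContinuousAt w a) : deriv (deriv w) a ≤ 0 := by
  by_contra! hpos
  have hmin : IsLocalMin w a := isLocalMin_of_deriv_deriv_pos hpos h.deriv_eq_zero hc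
  have hconst : w =ᶠ[𝓝 a] fun _ => w a := by
    filter_upwards [h, hmin] with t h₁ h₂ using le_antisymm h₁ h₂
  have : deriv (deriv w) a = 0 := by
    rw [hconst.deriv.deriv_eq]
    simp
  linarith

section Calculus

variable {E F : Type*} [NormedAddCommGroup E] [NormedSpace ℝ E]
  [NormedAddCommGroup F] [InnerProductSpace ℝ F]

/-- Second-order conditions at a local maximum of `u ∘ f`, along the line through `y₀` in the
direction `v`. The second derivative of `u ∘ f` is expanded by the chain rule. -/
theorem second_order_of_isLocalMax_comp {f : E → F} {y₀ : E} (hf : ContDiffAt ℝ 2 f y₀)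
    {u : F → ℝ} {u' : F → F →L[ℝ] ℝ} {u'' : F →L[ℝ] F →L[ℝ] ℝ}
    (hu : ∀ p, HasFDerivAt u (u' p) p) (hu' : HasFDerivAt u' u'' (f y₀))
    (hmax : IsLocalMax (u ∘ f) y₀) (v : E) :
    u' (f y₀) (fderiv ℝ f y₀ v) = 0 ∧
      u'' (fderiv ℝ f y₀ v) (fderiv ℝ f y₀ v) +
        u' (f y₀) (fderiv ℝ (fderiv ℝ f) y₀ v v) ≤ 0 := by
  have hf1 : ∀ᶠ y in 𝓝 y₀, HasFDerivAt f (fderiv ℝ f y) y := by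
    filter_upwards [hf.eventually (by simp)] with y hy
    exact (hy.differentiableAt (by simp)).hasFDerivAt
  have hf2 : HasFDerivAt (fderiv ℝ f) (fderiv ℝ (fderiv ℝ f) y₀) y₀ :=
    ((hf.fderiv_right (m := 1) (by norm_num)).differentiableAt (by simp)).hasFDerivAt
  set ℓ : ℝ → E := fun t => y₀ + t • v with hℓ
  have hℓ0 : ℓ 0 = y₀ := by simp [hℓ]
  have hℓd : ∀ t, HasDerivAt ℓ v t := fun t => by
    simpa [hℓ] using ((hasDerivAt_id t).smul_const v).const_add y₀
  have hℓt : Tendsto ℓ (𝓝 0) (𝓝 y₀) := by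
    simpa [hℓ0] using (hℓd 0).continuousAt.tendsto
  have hw1 : ∀ᶠ t in 𝓝 (0 : ℝ),
      HasDerivAt (u ∘ f ∘ ℓ) (u' (f (ℓ t)) (fderiv ℝ f (ℓ t) v)) t := by
    filter_upwards [hℓt.eventually hf1] with t ht
    exact (hu (f (ℓ t))).comp_hasDerivAt t (ht.comp_hasDerivAt t (hℓd t))
  have hc0 : HasDerivAt (f ∘ ℓ) (fderiv ℝ f y₀ v) 0 := by
    have := hf1.self_of_nhds
    rw [← hℓ0] at this ⊢
    exact this.comp_hasDerivAt 0 (hℓd 0)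
  have hA : HasDerivAt (fun t => u' (f (ℓ t))) (u'' (fderiv ℝ f y₀ v)) 0 := by
    have h : HasFDerivAt u' u'' ((f ∘ ℓ) 0) := by simpa [hℓ0] using hu'
    exact h.comp_hasDerivAt 0 hc0
  have hB : HasDerivAt (fun t => fderiv ℝ f (ℓ t) v) (fderiv ℝ (fderiv ℝ f) y₀ v v) 0 := by
    have h : HasFDerivAt (fderiv ℝ f) (fderiv ℝ (fderiv ℝ f) y₀) (ℓ 0) := by rwa [hℓ0]
    simpa using (h.comp_hasDerivAt 0 (hℓd 0)).clm_apply (hasDerivAt_const (0 : ℝ) v)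
  have hw2 := hA.clm_apply hB
  rw [hℓ0] at hw2
  have hmax' : IsLocalMax (u ∘ f ∘ ℓ) 0 := by
    have := hℓt.eventually hmax
    filter_upwards [this] with t ht
    simpa [hℓ0] using ht
  have hd : deriv (u ∘ f ∘ ℓ) =ᶠ[𝓝 0] fun t => u' (f (ℓ t)) (fderiv ℝ f (ℓ t) v) := by
    filter_upwards [hw1] with t ht using ht.deriv
  constructor
  · have := hmax'.deriv_eq_zero
    rw [hd.self_of_nhds] at this
    simpa only [hℓ0] using this
  · have := hmax'.deriv_deriv_nonpos hw1.self_of_nhds.continuousAt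
    rwa [hd.deriv_eq, hw2.deriv] at this

/-- Differentiating `⟨n, ∂ᵥ f⟩ = 0` expresses the normal part of the second derivative of a
parametrization by the derivative of the normal. -/
theorem inner_fderiv_fderiv_of_orthogonal {f n : E → F} {y₀ : E} (hf : ContDiffAt ℝ 2 f y₀)
    (hn : DifferentiableAt ℝ n y₀)
    (horth : ∀ᶠ y in 𝓝 y₀, ∀ v, inner ℝ (n y) (fderiv ℝ f y v) = 0) (v : E) :
    inner ℝ (n y₀) (fderiv ℝ (fderiv ℝ f) y₀ v v) =
      -inner ℝ (fderiv ℝ n y₀ v) (fderiv ℝ f y₀ v) := by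
  have hf2 : HasFDerivAt (fderiv ℝ f) (fderiv ℝ (fderiv ℝ f) y₀) y₀ :=
    ((hf.fderiv_right (m := 1) (by norm_num)).differentiableAt (by simp)).hasFDerivAt
  have h1 := hn.hasFDerivAt.inner ℝ (hf2.clm_apply (hasFDerivAt_const v y₀))
  have h2 : HasFDerivAt (fun y => inner ℝ (n y) (fderiv ℝ f y v)) (0 : E →L[ℝ] ℝ) y₀ :=
    (hasFDerivAt_const (0 : ℝ) y₀).congr_of_eventuallyEq (by
      filter_upwards [horth] with y hy using hy v)
  have h3 := congrArg (fun L => L v) (h1.unique h2)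
  simp [fderivInnerCLM_apply] at h3
  linarith

end Calculus

/-! ### Surfaces in charts -/

section Charts

variable {M : Type*} [TopologicalSpace M] [ChartedSpace (EuclideanSpace ℝ (Fin 2)) M]

/-- A map on a surface, read in the preferred chart at `x`. -/
noncomputable def inChart (G : M → E3) (x : M) : EuclideanSpace ℝ (Fin 2) → E3 :=
  G ∘ (extChartAt (𝓡 2) x).symm

theorem inChart_self (G : M → E3) (x : M) : inChart G x (extChartAt (𝓡 2) x x) = G x := by
  simp [inChart]

theorem extChartAt_symm_tendsto (x : M) :
    Tendsto (extChartAt (𝓡 2) x).symm (𝓝 (extChartAt (𝓡 2) x x)) (𝓝 x) := by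
  simpa using (continuousAt_extChartAt_symm (I := 𝓡 2) x).tendsto

/-- The differential of a map `M → ℝ³`, as a linear map on the model space `ℝ²`, to which the
tangent space is definitionally equal. -/
noncomputable def differential (G : M → E3) (x : M) : EuclideanSpace ℝ (Fin 2) →L[ℝ] E3 :=
  mfderiv (𝓡 2) 𝓘(ℝ, E3) G x

theorem hasFDerivAt_inChart {G : M → E3} {x : M}
    (hG : MDifferentiableAt (𝓡 2) 𝓘(ℝ, E3) G x) :
    HasFDerivAt (inChart G x) (differential G x) (extChartAt (𝓡 2) x x) := by
  have h := hG.hasMFDerivAt.2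
  rw [ModelWithCorners.range_eq_univ] at h
  exact hasFDerivWithinAt_univ.1 h

theorem ContMDiff.fderiv_inChart {G : M → E3} (hG : ContMDiff (𝓡 2) 𝓘(ℝ, E3) ∞ G) (x : M) :
    fderiv ℝ (inChart G x) (extChartAt (𝓡 2) x x) = differential G x :=
  (hasFDerivAt_inChart (hG.mdifferentiable (by simp) x)).fderiv

variable [IsManifold (𝓡 2) ∞ M]

theorem contDiffAt_inChart {G : M → E3} (hG : ContMDiff (𝓡 2) 𝓘(ℝ, E3) ∞ G) (x : M) :
    ContDiffAt ℝ ∞ (inChart G x) (extChartAt (𝓡 2) x x) := by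
  have h := (contMDiffOn_extChartAt_symm (I := 𝓡 2) (n := ∞) x)
  have h' := (hG.comp_contMDiffOn h).contDiffOn
  exact h'.contDiffAt (extChartAt_target_mem_nhds x)

variable {Φ ν : M → E3}

/-- The normal field is orthogonal to the partial derivatives in the chart at `x`, also at the
points near `x`, whose own preferred chart may be a different one. -/
theorem IsOrientedImmersion.eventually_orthogonal (h : IsOrientedImmersion Φ ν) (x : M) :
    ∀ᶠ y in 𝓝 (extChartAt (𝓡 2) x x), ∀ v,
      inner ℝ (inChart ν x y) (fderiv ℝ (inChart Φ x) y v) = 0 := by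
  filter_upwards [extChartAt_target_mem_nhds (I := 𝓡 2) x] with y hy v
  have h1 : MDifferentiableAt 𝓘(ℝ, EuclideanSpace ℝ (Fin 2)) (𝓡 2)
      (extChartAt (𝓡 2) x).symm y :=
    (mdifferentiableOn_extChartAt_symm (I := 𝓡 2) (x := x)).mdifferentiableAt
      ((isOpen_extChartAt_target x).mem_nhds hy)
  have h2 : MDifferentiableAt (𝓡 2) 𝓘(ℝ, E3) Φ ((extChartAt (𝓡 2) x).symm y) :=
    h.smooth.mdifferentiable (by simp) _
  have h3 : fderiv ℝ (inChart Φ x) y v = mfderiv (𝓡 2) 𝓘(ℝ, E3) Φ ((extChartAt (𝓡 2) x).symm y)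
      (mfderiv 𝓘(ℝ, EuclideanSpace ℝ (Fin 2)) (𝓡 2) (extChartAt (𝓡 2) x).symm y v) := by
    have := mfderiv_comp y h2 h1
    rw [mfderiv_eq_fderiv] at this
    exact congrArg (fun L => L v) this
  rw [h3]
  exact h.orthogonal _ _

end Charts

/-! ### Adapted frames and the mean curvature -/

/-- Two orthonormal vectors orthogonal to a unit vector complete it to an orthonormal basis of
`ℝ³`. -/
theorem exists_orthonormalBasis_of_normal {n : E3} (hn : ‖n‖ = 1) {e : Fin 2 → E3}
    (he : Orthonormal ℝ e) (hne : ∀ i, inner ℝ n (e i) = 0) :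
    ∃ b : OrthonormalBasis (Fin 3) ℝ E3, b 0 = n ∧ b 1 = e 0 ∧ b 2 = e 1 := by
  have h1 : ∀ i, ‖e i‖ = 1 := he.1
  have h01 : inner ℝ (e 0) (e 1) = 0 := he.2 (by decide)
  have ho : Orthonormal ℝ ![n, e 0, e 1] := by
    constructor
    · intro i; fin_cases i <;> simp [hn, h1]
    · intro i j hij
      fin_cases i <;> fin_cases j <;> simp_all [real_inner_comm]
  have hspan := (basisOfOrthonormalOfCardEqFinrank ho (by simp)).span_eq
  rw [coe_basisOfOrthonormalOfCardEqFinrank] at hspan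
  exact ⟨OrthonormalBasis.mk ho hspan.ge, by simp, by simp, by simp⟩

/-- Parseval's identity for an orthonormal frame of the plane orthogonal to `n`. -/
theorem sum_inner_frame {n : E3} (hn : ‖n‖ = 1) {e : Fin 2 → E3}
    (he : Orthonormal ℝ e) (hne : ∀ i, inner ℝ n (e i) = 0) (u w : E3) :
    ∑ i, inner ℝ u (e i) * inner ℝ w (e i) = inner ℝ u w - inner ℝ u n * inner ℝ w n := by
  obtain ⟨b, h0, h1, h2⟩ := exists_orthonormalBasis_of_normal hn he hne
  have := b.sum_inner_mul_inner u w
  rw [Fin.sum_univ_three, h0, h1, h2] at this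
  rw [Fin.sum_univ_two, ← this, real_inner_comm w, real_inner_comm w, real_inner_comm w]
  ring

/-- A functional that vanishes on the plane orthogonal to `n` only sees the normal component. -/
theorem apply_eq_inner_mul_of_frame {n : E3} (hn : ‖n‖ = 1) {e : Fin 2 → E3}
    (he : Orthonormal ℝ e) (hne : ∀ i, inner ℝ n (e i) = 0) (L : E3 →L[ℝ] ℝ)
    (hL : ∀ i, L (e i) = 0) (w : E3) : L w = inner ℝ n w * L n := by
  obtain ⟨b, h0, h1, h2⟩ := exists_orthonormalBasis_of_normal hn he hne
  conv_lhs => rw [← b.sum_repr' w]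
  simp [Fin.sum_univ_three, h0, h1, h2, hL]

section Surfaces

variable {M : Type*} [TopologicalSpace M] [ChartedSpace (EuclideanSpace ℝ (Fin 2)) M]
  {Φ ν : M → E3}

theorem differential_apply (G : M → E3) (x : M) (v : EuclideanSpace ℝ (Fin 2)) :
    differential G x v = ∑ i, v i • partialDeriv G x i := by
  conv_lhs => rw [← (EuclideanSpace.basisFun (Fin 2) ℝ).sum_repr v]
  rw [map_sum]
  refine Finset.sum_congr rfl fun i _ => ?_
  rw [map_smul]
  simp only [EuclideanSpace.basisFun_repr, EuclideanSpace.basisFun_apply]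
  rfl

/-- Every tangent plane has an orthonormal frame, and the mean curvature is the trace of the second
fundamental form in this frame. -/
theorem IsOrientedImmersion.exists_frame (h : IsOrientedImmersion Φ ν) (x : M) :
    ∃ v : Fin 2 → EuclideanSpace ℝ (Fin 2),
      Orthonormal ℝ (fun i => differential Φ x (v i)) ∧
      meanCurvature Φ ν x =
        ∑ i, -inner ℝ (differential ν x (v i)) (differential Φ x (v i)) := by
  have hinj : Function.Injective (differential Φ x) := h.immersion x
  set V := LinearMap.range (differential Φ x).toLinearMap with hV
  have hdim : Module.finrank ℝ V = 2 := by
    rw [hV, LinearMap.finrank_range_of_inj hinj]; simp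
  set b := (stdOrthonormalBasis ℝ V).reindex (finCongr hdim) with hb
  have hex : ∀ i, ∃ v, differential Φ x v = (b i : E3) := fun i => (b i).2
  choose v hv using hex
  have ho : Orthonormal ℝ (fun i => differential Φ x (v i)) := by
    simp only [hv]
    exact b.orthonormal.comp_linearIsometry V.subtypeₗᵢ
  refine ⟨v, ho, ?_⟩
  set P : Matrix (Fin 2) (Fin 2) ℝ := Matrix.of fun j i => v i j with hP
  -- A bilinear form `⟨A v, B w⟩` in the frame is congruent by `P` to its coordinate matrix.
  have key : ∀ G : M → E3, ∀ i k,
      (Pᵀ * Matrix.of (fun i j => inner ℝ (partialDeriv G x i) (partialDeriv Φ x j)) * P) i k =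
        inner ℝ (differential G x (v i)) (differential Φ x (v k)) := by
    intro G i k
    simp only [differential_apply, Matrix.mul_apply, Fin.sum_univ_two, hP, Matrix.of_apply,
      Matrix.transpose_apply, inner_add_left, inner_add_right, real_inner_smul_left,
      real_inner_smul_right]
    ring
  have hg : Pᵀ * firstFundamentalForm Φ x * P = 1 := by
    ext i k
    rw [firstFundamentalForm, key, orthonormal_iff_ite.1 ho, Matrix.one_apply]
  have hginv : (firstFundamentalForm Φ x)⁻¹ = P * Pᵀ := by
    have h1 : P * (Pᵀ * firstFundamentalForm Φ x) = 1 := mul_eq_one_comm.1 hg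
    exact Matrix.inv_eq_left_inv (by rw [Matrix.mul_assoc, h1])
  have hh : secondFundamentalForm Φ ν x =
      -Matrix.of (fun i j => inner ℝ (partialDeriv ν x i) (partialDeriv Φ x j)) := by
    ext i j; simp [secondFundamentalForm]
  rw [meanCurvature, hginv, Matrix.mul_assoc, Matrix.trace_mul_comm, hh, Matrix.mul_neg,
    Matrix.neg_mul, Matrix.trace_neg, Matrix.trace, ← Finset.sum_neg_distrib]
  exact Finset.sum_congr rfl fun i _ => by rw [Matrix.diag_apply, key]

/-- The second-derivative test for the restriction of an ambient function `u` to a surface. The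
trace of the Hessian of the restriction at a critical point is the trace of the ambient Hessian over
the tangent plane plus the mean curvature times the normal derivative, so at a local maximum this
quantity is nonpositive. -/
theorem IsOrientedImmersion.second_order_of_isLocalMax [IsManifold (𝓡 2) ∞ M]
    (h : IsOrientedImmersion Φ ν) {x : M}
    {u : E3 → ℝ} {u' : E3 → E3 →L[ℝ] ℝ} {u'' : E3 →L[ℝ] E3 →L[ℝ] ℝ}
    (hu : ∀ p, HasFDerivAt u (u' p) p) (hu' : HasFDerivAt u' u'' (Φ x))
    (hmax : IsLocalMax (u ∘ Φ) x) :
    ∃ e : Fin 2 → E3, Orthonormal ℝ e ∧ (∀ i, inner ℝ (ν x) (e i) = 0) ∧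
      (∀ i, u' (Φ x) (e i) = 0) ∧
      ∑ i, u'' (e i) (e i) + meanCurvature Φ ν x * u' (Φ x) (ν x) ≤ 0 := by
  obtain ⟨v, ho, hH⟩ := h.exists_frame x
  set y₀ := extChartAt (𝓡 2) x x with hy₀
  have hf : ContDiffAt ℝ 2 (inChart Φ x) y₀ :=
    (contDiffAt_inChart h.smooth x).of_le (WithTop.coe_le_coe.2 (le_top : (2 : ℕ∞) ≤ ⊤))
  have hn : DifferentiableAt ℝ (inChart ν x) y₀ :=
    (contDiffAt_inChart h.smooth_normal x).differentiableAt (by simp)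
  have hΦ0 : inChart Φ x y₀ = Φ x := inChart_self Φ x
  have hν0 : inChart ν x y₀ = ν x := inChart_self ν x
  have hmax' : IsLocalMax (u ∘ inChart Φ x) y₀ := by
    filter_upwards [(extChartAt_symm_tendsto x).eventually hmax] with y hy
    change u (inChart Φ x y) ≤ u (inChart Φ x y₀)
    rw [hΦ0]
    exact hy
  have hne : ∀ i, inner ℝ (ν x) (differential Φ x (v i)) = 0 := fun i => h.orthogonal x (v i)
  have h1 := fun i => second_order_of_isLocalMax_comp hf hu (hΦ0 ▸ hu') hmax' (v i)
  have h2 := fun i => inner_fderiv_fderiv_of_orthogonal hf hn (h.eventually_orthogonal x) (v i)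
  rw [h.smooth.fderiv_inChart x] at h1 h2
  rw [h.smooth_normal.fderiv_inChart x] at h2
  simp only [hΦ0, hν0] at h1 h2
  refine ⟨_, ho, hne, fun i => (h1 i).1, ?_⟩
  have h3 := fun i => apply_eq_inner_mul_of_frame (h.norm_normal x) ho hne (u' (Φ x))
    (fun i => (h1 i).1) (fderiv ℝ (fderiv ℝ (inChart Φ x)) y₀ (v i) (v i))
  have h4 := Finset.sum_nonpos fun i (_ : i ∈ Finset.univ) => (h1 i).2
  rw [hH, Finset.sum_mul, ← Finset.sum_add_distrib]
  refine le_of_eq_of_le (Finset.sum_congr rfl fun i _ => ?_) h4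
  rw [h3, h2]

end Surfaces

/-! ### The test functions `|p|²` and the Gaussian of the distance to a line -/

/-- The inner product of `ℝ³` as a continuous bilinear map. -/
noncomputable def innerCLM : E3 →L[ℝ] E3 →L[ℝ] ℝ := innerSL ℝ

theorem innerCLM_apply (v w : E3) : innerCLM v w = inner ℝ v w := rfl

/-- The projection along the vector `n`, orthogonal if `n` is a unit vector. -/
noncomputable def projAlong (n : E3) : E3 →L[ℝ] E3 :=
  ContinuousLinearMap.id ℝ E3 - (innerCLM n).smulRight n

theorem projAlong_apply (n p : E3) : projAlong n p = p - inner ℝ n p • n := by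
  simp [projAlong, innerCLM_apply]

theorem inner_projAlong_self {n : E3} (hn : ‖n‖ = 1) (p : E3) : inner ℝ n (projAlong n p) = 0 := by
  rw [projAlong_apply, inner_sub_right, inner_smul_right, real_inner_self_eq_norm_sq, hn]
  ring

theorem inner_projAlong (n p q : E3) :
    inner ℝ (projAlong n p) q = inner ℝ p q - inner ℝ n p * inner ℝ n q := by
  rw [projAlong_apply, inner_sub_left, real_inner_smul_left]

theorem inner_projAlong_projAlong {n : E3} (hn : ‖n‖ = 1) (p q : E3) :
    inner ℝ (projAlong n p) (projAlong n q) = inner ℝ (projAlong n p) q := by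
  rw [projAlong_apply n q, inner_sub_right, inner_smul_right,
    real_inner_comm n, inner_projAlong_self hn]
  ring

theorem hasFDerivAt_norm_sq (p : E3) :
    HasFDerivAt (fun p : E3 => ‖p‖ ^ 2) ((2 : ℝ) • innerCLM p) p := by
  refine (hasStrictFDerivAt_norm_sq p).hasFDerivAt.congr_fderiv ?_
  ext w
  simp [innerCLM_apply]

theorem hasFDerivAt_two_smul_innerSL (p : E3) :
    HasFDerivAt (fun p : E3 => (2 : ℝ) • innerCLM p) ((2 : ℝ) • innerCLM) p :=
  ((2 : ℝ) • innerCLM).hasFDerivAt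

/-- A Gaussian of the distance to the line through `c` in the direction `n`. -/
noncomputable def lineGaussian (n c : E3) (β : ℝ) (p : E3) : ℝ :=
  Real.exp (-β * ‖projAlong n (p - c)‖ ^ 2)

theorem hasFDerivAt_lineGaussian {n : E3} (hn : ‖n‖ = 1) (c : E3) (β : ℝ) (p : E3) :
    HasFDerivAt (lineGaussian n c β)
      ((-2 * β * lineGaussian n c β p) • innerCLM (projAlong n (p - c))) p := by
  have h1 : HasFDerivAt (fun p : E3 => projAlong n (p - c)) (projAlong n) p :=
    (projAlong n).hasFDerivAt.comp p ((hasFDerivAt_id p).sub_const c)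
  have h2 := ((hasFDerivAt_norm_sq (projAlong n (p - c))).comp p h1).const_mul (-β)
  refine h2.exp.congr_fderiv ?_
  ext w
  simp only [smul_apply, ContinuousLinearMap.comp_apply, innerCLM_apply,
    smul_eq_mul, lineGaussian, inner_projAlong_projAlong hn, Function.comp_apply]
  ring

theorem hasFDerivAt_fderiv_lineGaussian {n : E3} (hn : ‖n‖ = 1) (c : E3) (β : ℝ) (p : E3) :
    HasFDerivAt
      (fun p => (-2 * β * lineGaussian n c β p) • innerCLM (projAlong n (p - c)))
      ((-2 * β * lineGaussian n c β p) • innerCLM.comp (projAlong n) +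
        ((-2 * β) • (-2 * β * lineGaussian n c β p) •
          innerCLM (projAlong n (p - c))).smulRight (innerCLM (projAlong n (p - c)))) p := by
  have h1 : HasFDerivAt (fun p : E3 => projAlong n (p - c)) (projAlong n) p :=
    (projAlong n).hasFDerivAt.comp p ((hasFDerivAt_id p).sub_const c)
  have h2 := innerCLM.hasFDerivAt.comp p h1
  exact ((hasFDerivAt_lineGaussian hn c β p).const_mul (-2 * β)).smul h2

section Surfaces

variable {M : Type*} [TopologicalSpace M] [ChartedSpace (EuclideanSpace ℝ (Fin 2)) M]
  [IsManifold (𝓡 2) ∞ M] {Φ ν : M → E3}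

/-- At a critical point of `|Φ|` the position vector is normal; at a local maximum of `|Φ|`
moreover `2 + H ⟨ν, Φ⟩ ≤ 0`, which is the comparison of the surface with the touching sphere. -/
theorem IsOrientedImmersion.meanCurvature_of_isLocalMax (h : IsOrientedImmersion Φ ν) {x : M}
    (hmax : IsLocalMax (fun y => ‖Φ y‖ ^ 2) x) :
    Φ x = inner ℝ (ν x) (Φ x) • ν x ∧ 2 + meanCurvature Φ ν x * inner ℝ (ν x) (Φ x) ≤ 0 := by
  obtain ⟨e, he, hne, h0, h1⟩ := h.second_order_of_isLocalMax hasFDerivAt_norm_sq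
    (hasFDerivAt_two_smul_innerSL (Φ x)) hmax
  constructor
  · refine ext_inner_left ℝ fun w => ?_
    have := apply_eq_inner_mul_of_frame (h.norm_normal x) he hne _ h0 w
    simp only [smul_apply, innerCLM_apply, smul_eq_mul] at this
    rw [inner_smul_right, real_inner_comm, real_inner_comm (ν x) w, real_inner_comm (Φ x)]
    linarith
  · simp only [smul_apply, innerCLM_apply, smul_eq_mul,
      real_inner_self_eq_norm_sq, he.1, Fin.sum_univ_two] at h1
    rw [real_inner_comm] at h1
    linarith

/-- The analogue of `IsOrientedImmersion.meanCurvature_of_isLocalMax` at a local minimum. -/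
theorem IsOrientedImmersion.meanCurvature_of_isLocalMin (h : IsOrientedImmersion Φ ν) {x : M}
    (hmin : IsLocalMin (fun y => ‖Φ y‖ ^ 2) x) :
    Φ x = inner ℝ (ν x) (Φ x) • ν x ∧ 0 ≤ 2 + meanCurvature Φ ν x * inner ℝ (ν x) (Φ x) := by
  obtain ⟨e, he, hne, h0, h1⟩ := h.second_order_of_isLocalMax
    (fun p => (hasFDerivAt_norm_sq p).neg) (hasFDerivAt_two_smul_innerSL (Φ x)).neg hmin.neg
  constructor
  · refine ext_inner_left ℝ fun w => ?_
    have := apply_eq_inner_mul_of_frame (h.norm_normal x) he hne _ h0 w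
    simp only [neg_apply, smul_apply, innerCLM_apply,
      smul_eq_mul] at this
    rw [inner_smul_right, real_inner_comm, real_inner_comm (ν x) w, real_inner_comm (Φ x)]
    linarith
  · simp only [neg_apply, smul_apply, innerCLM_apply,
      smul_eq_mul, real_inner_self_eq_norm_sq, he.1, Fin.sum_univ_two] at h1
    rw [real_inner_comm] at h1
    linarith

/-- If `|Φ|²` is subharmonic at `x`, then adding to it a Gaussian that is steep enough gives a
function that is strictly subharmonic at `x`, hence has no local maximum there. The axis of the
Gaussian is almost normal to the surface and at distance `‖projAlong n (Φ x - c)‖` from `Φ x`. -/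
theorem IsOrientedImmersion.not_isLocalMax_add_lineGaussian (h : IsOrientedImmersion Φ ν) {x : M}
    (hsub : 0 ≤ 2 + meanCurvature Φ ν x * inner ℝ (ν x) (Φ x))
    {n : E3} (hn : ‖n‖ = 1) (hνn : ‖ν x - n‖ ≤ 1 / 2) (c : E3) {ε β K : ℝ} (hε : 0 < ε) (hβ : 0 < β)
    (hH : |meanCurvature Φ ν x| ≤ K) (hβ1 : 3 ≤ β * ‖projAlong n (Φ x - c)‖ ^ 2)
    (hβ2 : K ≤ β * ‖projAlong n (Φ x - c)‖) :
    ¬ IsLocalMax (fun y => ‖Φ y‖ ^ 2 + ε * lineGaussian n c β (Φ y)) x := by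
  intro hmax
  obtain ⟨e, he, hne, -, h1⟩ := h.second_order_of_isLocalMax
    (fun p => (hasFDerivAt_norm_sq p).add ((hasFDerivAt_lineGaussian hn c β p).const_mul ε))
    ((hasFDerivAt_two_smul_innerSL (Φ x)).add
      ((hasFDerivAt_fderiv_lineGaussian hn c β (Φ x)).const_smul ε)) hmax
  set q := projAlong n (Φ x - c) with hq
  set G := lineGaussian n c β (Φ x) with hG
  set H := meanCurvature Φ ν x with hHdef
  have hG0 : 0 < G := Real.exp_pos _
  have hpars := sum_inner_frame (h.norm_normal x) he hne q q
  have hqn : inner ℝ n q = 0 := inner_projAlong_self hn _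
  -- `q` is orthogonal to `n`, hence almost tangent to the surface.
  have hqν : |inner ℝ q (ν x)| ≤ ‖q‖ * (1 / 2) := by
    have : inner ℝ q (ν x) = inner ℝ q (ν x - n) := by
      rw [inner_sub_right, real_inner_comm n q, hqn, sub_zero]
    rw [this]
    exact (abs_real_inner_le_norm _ _).trans (by gcongr)
  have hqν2 : inner ℝ q (ν x) ^ 2 ≤ ‖q‖ ^ 2 / 4 := by
    calc inner ℝ q (ν x) ^ 2 = |inner ℝ q (ν x)| ^ 2 := (sq_abs _).symm
      _ ≤ (‖q‖ * (1 / 2)) ^ 2 := by gcongr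
      _ = ‖q‖ ^ 2 / 4 := by ring
  have hHq : H * inner ℝ q (ν x) ≤ β * ‖q‖ * (‖q‖ * (1 / 2)) := by
    calc H * inner ℝ q (ν x) ≤ |H| * |inner ℝ q (ν x)| := by
          rw [← abs_mul]; exact le_abs_self _
      _ ≤ β * ‖q‖ * (‖q‖ * (1 / 2)) := by
          gcongr
          exact hH.trans hβ2
  simp only [add_apply, smul_apply, innerCLM_apply,
    ContinuousLinearMap.comp_apply, ContinuousLinearMap.smulRight_apply, inner_projAlong,
    smul_eq_mul, real_inner_self_eq_norm_sq, he.1, Fin.sum_univ_two] at h1 hpars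
  rw [real_inner_comm (ν x) (Φ x)] at h1
  -- The left-hand side of `h1` for the Gaussian alone, divided by `2 * β * G`, is positive.
  have hfin : 0 < 2 * β * (‖q‖ ^ 2 - inner ℝ q (ν x) ^ 2) - (2 - inner ℝ n (e 0) ^ 2 -
      inner ℝ n (e 1) ^ 2) - H * inner ℝ q (ν x) := by
    have := mul_le_mul_of_nonneg_left hqν2 hβ.le
    nlinarith [sq_nonneg (inner ℝ n (e 0)), sq_nonneg (inner ℝ n (e 1))]
  have hpos := mul_pos (mul_pos (mul_pos two_pos hε) (mul_pos hβ hG0)) hfin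
  rw [show ‖q‖ ^ 2 - inner ℝ q (ν x) ^ 2 = inner ℝ q (e 0) * inner ℝ q (e 0) +
    inner ℝ q (e 1) * inner ℝ q (e 1) by rw [hpars]; ring] at hpos
  linarith

end Surfaces

/-! ### Tangential coordinates on an immersed surface -/

section Surfaces

variable {M : Type*} [TopologicalSpace M] [ChartedSpace (EuclideanSpace ℝ (Fin 2)) M]
  {Φ ν : M → E3}

/-- The inverse of the differential on the tangent plane, extended by zero in the normal
direction. -/
theorem IsOrientedImmersion.exists_tangentCoord (h : IsOrientedImmersion Φ ν) (x : M) :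
    ∃ θ : E3 →L[ℝ] EuclideanSpace ℝ (Fin 2),
      (∀ p, differential Φ x (θ p) = projAlong (ν x) p) ∧
        θ.comp (differential Φ x) = ContinuousLinearMap.id ℝ _ := by
  obtain ⟨v, ho, -⟩ := h.exists_frame x
  have hne : ∀ i, inner ℝ (ν x) (differential Φ x (v i)) = 0 := fun i => h.orthogonal x (v i)
  obtain ⟨b, h0, h1, h2⟩ := exists_orthonormalBasis_of_normal (h.norm_normal x) ho hne
  let θ : E3 →L[ℝ] EuclideanSpace ℝ (Fin 2) :=
    ∑ i, (innerCLM (differential Φ x (v i))).smulRight (v i)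
  have hθ : ∀ p, differential Φ x (θ p) = projAlong (ν x) p := by
    intro p
    have hp := b.sum_repr' p
    rw [Fin.sum_univ_three, h0, h1, h2] at hp
    rw [projAlong_apply]
    conv_rhs => rw [← hp]
    simp only [θ, Fin.sum_univ_two, add_apply, ContinuousLinearMap.smulRight_apply,
      innerCLM_apply, map_add, map_smul, inner_add_right, inner_smul_right, hne,
      real_inner_self_eq_norm_sq, h.norm_normal x]
    module
  refine ⟨θ, hθ, ?_⟩
  ext1 w
  have hinj : Function.Injective (differential Φ x) := h.immersion x
  apply hinj
  have hw : inner ℝ (ν x) (differential Φ x w) = 0 := h.orthogonal x w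
  simp [hθ, projAlong_apply, hw]

/-- The tangential coordinate is a local homeomorphism at `x`, by the inverse function theorem. -/
theorem IsOrientedImmersion.tangentCoord_local [IsManifold (𝓡 2) ∞ M]
    (h : IsOrientedImmersion Φ ν) (x : M)
    {θ : E3 →L[ℝ] EuclideanSpace ℝ (Fin 2)}
    (hθ : θ.comp (differential Φ x) = ContinuousLinearMap.id ℝ _) :
    (∃ U ∈ 𝓝 x, InjOn (fun y => θ (Φ y)) U) ∧
      𝓝 (θ (Φ x)) ≤ map (fun y => θ (Φ y)) (𝓝 x) := by
  set φ := extChartAt (𝓡 2) x with hφ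
  have hf : HasStrictFDerivAt (inChart Φ x) (differential Φ x) (φ x) := by
    rw [← h.smooth.fderiv_inChart x]
    exact (contDiffAt_inChart h.smooth x).hasStrictFDerivAt (by simp)
  have hg : HasStrictFDerivAt (fun y => θ (inChart Φ x y))
      ((ContinuousLinearEquiv.refl ℝ (EuclideanSpace ℝ (Fin 2)) :
        EuclideanSpace ℝ (Fin 2) →L[ℝ] EuclideanSpace ℝ (Fin 2))) (φ x) := by
    have := θ.hasStrictFDerivAt.comp (φ x) hf
    rw [hθ] at this
    exact this
  set e := hg.toOpenPartialHomeomorph _ with he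
  have hcoe : ∀ y, e y = θ (inChart Φ x y) := fun y => rfl
  have hsrc : φ x ∈ e.source := hg.mem_toOpenPartialHomeomorph_source
  have hback : ∀ y ∈ φ.source, inChart Φ x (φ y) = Φ y := by
    intro y hy
    simp only [inChart, Function.comp_apply]
    rw [← hφ, φ.left_inv hy]
  have hφc : Tendsto φ (𝓝 x) (𝓝 (φ x)) := continuousAt_extChartAt x
  constructor
  · refine ⟨φ.source ∩ φ ⁻¹' e.source, inter_mem (extChartAt_source_mem_nhds x)
      (hφc (e.open_source.mem_nhds hsrc)), ?_⟩
    rintro y ⟨hy, hy'⟩ z ⟨hz, hz'⟩ hyz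
    refine φ.injOn hy hz (e.injOn hy' hz' ?_)
    rw [hcoe, hcoe, hback y hy, hback z hz]
    exact hyz
  · have h1 : 𝓝 (θ (Φ x)) = map (fun y => θ (inChart Φ x y)) (𝓝 (φ x)) := by
      have := e.map_nhds_eq hsrc
      rw [hcoe, inChart_self] at this
      exact this.symm
    rw [h1]
    have h2 : (fun y => θ (inChart Φ x y)) = (fun y => θ (Φ y)) ∘ φ.symm := rfl
    rw [h2, ← Filter.map_map]
    exact Filter.map_mono (extChartAt_symm_tendsto x)

/-- The projection to the tangent plane at `x` is injective on the surface near `x`. -/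
theorem IsOrientedImmersion.injOn_projAlong [IsManifold (𝓡 2) ∞ M]
    (h : IsOrientedImmersion Φ ν) (x : M) :
    ∃ U ∈ 𝓝 x, InjOn (fun y => projAlong (ν x) (Φ y)) U := by
  obtain ⟨θ, hθ, hid⟩ := h.exists_tangentCoord x
  obtain ⟨U, hU, hinj⟩ := (h.tangentCoord_local x hid).1
  refine ⟨U, hU, fun y hy z hz hyz => hinj hy hz ?_⟩
  have hproj : ∀ p, θ (projAlong (ν x) p) = θ p := fun p => by
    rw [← hθ]
    exact DFunLike.congr_fun hid (θ p)
  simp only at hyz ⊢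
  rw [← hproj, hyz, hproj]

/-! ### The strong maximum principle for `|Φ|²` -/

/-- Hopf's argument. If `|Φ|²` is subharmonic, the set where it attains its maximum is open. At a
boundary point of this set on a disc (in the tangential coordinate) in the complement, a Gaussian
centred in the disc would turn `|Φ|²` into a strictly subharmonic function with a local maximum. -/
theorem IsOrientedImmersion.eventually_norm_sq_eq [IsManifold (𝓡 2) ∞ M] [T2Space M]
    [LocallyCompactSpace M] (h : IsOrientedImmersion Φ ν)
    (hsub : ∀ x, 0 ≤ 2 + meanCurvature Φ ν x * inner ℝ (ν x) (Φ x))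
    {K : ℝ} (hK : 0 ≤ K) (hH : ∀ x, |meanCurvature Φ ν x| ≤ K) {m : ℝ} (hm : ∀ x, ‖Φ x‖ ^ 2 ≤ m)
    {x₁ : M} (hx₁ : ‖Φ x₁‖ ^ 2 = m) : ∀ᶠ y in 𝓝 x₁, ‖Φ y‖ ^ 2 = m := by
  have hΦc : Continuous Φ := h.smooth.continuous
  have hνc : Continuous ν := h.smooth_normal.continuous
  set n := ν x₁ with hn
  have hn1 : ‖n‖ = 1 := h.norm_normal x₁
  set ψ : M → E3 := fun x => projAlong n (Φ x) with hψ
  have hψc : Continuous ψ := (projAlong n).continuous.comp hΦc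
  obtain ⟨U, hU, hinj⟩ := h.injOn_projAlong x₁
  have hV : {x | ‖ν x - n‖ ≤ 1 / 2} ∈ 𝓝 x₁ := by
    have : ContinuousAt (fun x => ‖ν x - n‖) x₁ := by fun_prop
    have h' := this.tendsto.eventually (gt_mem_nhds (show ‖ν x₁ - n‖ < 1 / 2 by simp [hn]))
    exact h'.mono fun x hx => hx.le
  obtain ⟨N, hN, hNsub, hNc⟩ := local_compact_nhds (inter_mem hU hV)
  have hNinj : InjOn ψ N := hinj.mono fun x hx => (hNsub hx).1
  have hNclosed : IsClosed N := hNc.isClosed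
  have hx₁N : x₁ ∈ N := mem_of_mem_nhds hN
  have hx₁int : x₁ ∈ interior N := mem_interior_iff_mem_nhds.2 hN
  -- The collar `N \ interior N` stays at a positive distance `η` from `x₁`.
  obtain ⟨η, hη, hηN⟩ : ∃ η > 0, ∀ x ∈ N \ interior N, η ≤ ‖ψ x - ψ x₁‖ := by
    have hc : IsCompact (N \ interior N) := hNc.diff isOpen_interior
    obtain hE | hE := (N \ interior N).eq_empty_or_nonempty
    · exact ⟨1, one_pos, fun x hx => by simp [hE] at hx⟩
    · obtain ⟨z, hz, hzmin⟩ := hc.exists_isMinOn hE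
        (f := fun x => ‖ψ x - ψ x₁‖) (by fun_prop)
      refine ⟨‖ψ z - ψ x₁‖, norm_pos_iff.2 (sub_ne_zero.2 fun heq => ?_), fun x hx => hzmin hx⟩
      exact hz.2 (hNinj hz.1 hx₁N heq ▸ hx₁int)
  have hW : {y | ‖ψ y - ψ x₁‖ < η / 2} ∈ 𝓝 x₁ := by
    have : ContinuousAt (fun y => ‖ψ y - ψ x₁‖) x₁ := by fun_prop
    exact this.tendsto.eventually (gt_mem_nhds (by simpa using hη))
  filter_upwards [hN, hW] with y hyN hyη
  by_contra hne
  have hym : ‖Φ y‖ ^ 2 < m := lt_of_le_of_ne (hm y) hne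
  -- `x₂` is the point of the maximum set closest to `y`.
  set A := N ∩ {x | ‖Φ x‖ ^ 2 = m} with hA
  have hAc : IsCompact A := hNc.inter_right (isClosed_eq (by fun_prop) continuous_const)
  obtain ⟨x₂, hx₂A, hx₂min⟩ := hAc.exists_isMinOn ⟨x₁, hx₁N, hx₁⟩
    (f := fun x => ‖ψ x - ψ y‖) (by fun_prop)
  set R := ‖ψ x₂ - ψ y‖ with hR
  have hRmin : ∀ x ∈ A, R ≤ ‖ψ x - ψ y‖ := fun x hx => hx₂min hx
  have hRη : R < η / 2 := by
    refine (hRmin x₁ ⟨hx₁N, hx₁⟩).trans_lt ?_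
    rwa [norm_sub_rev]
  have hRpos : 0 < R := by
    refine norm_pos_iff.2 (sub_ne_zero.2 fun heq => ?_)
    have := hNinj hx₂A.1 hyN heq
    exact hym.ne (this ▸ hx₂A.2)
  have hx₂int : x₂ ∈ interior N := by
    by_contra hx
    have h1 := hηN x₂ ⟨hx₂A.1, hx⟩
    have h2 : ‖ψ x₂ - ψ x₁‖ ≤ ‖ψ x₂ - ψ y‖ + ‖ψ y - ψ x₁‖ := norm_sub_le_norm_sub_add_norm_sub ..
    have h3 : ‖ψ y - ψ x₁‖ < η / 2 := hyη
    linarith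
  -- The disc around the midpoint `c` meets the maximum set only at `x₂`.
  set c : E3 := (1 / 2 : ℝ) • (Φ x₂ + Φ y) with hc
  set d : M → ℝ := fun x => ‖projAlong n (Φ x - c)‖ with hd
  have hdc : Continuous d := by fun_prop
  have hdx : ∀ x, projAlong n (Φ x - c) = ψ x - (1 / 2 : ℝ) • (ψ x₂ + ψ y) := fun x => by
    simp [hc, hψ, map_sub, map_smul, map_add]
  have hdx₂ : d x₂ = R / 2 := by
    have : projAlong n (Φ x₂ - c) = (1 / 2 : ℝ) • (ψ x₂ - ψ y) := by
      rw [hdx]; module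
    rw [hd]
    simp only [this, norm_smul]
    rw [← hR]; norm_num; ring
  have hAd : ∀ x ∈ A, d x ≤ R / 2 → x = x₂ := by
    intro x hx hxd
    refine hNinj hx.1 hx₂A.1 (sub_eq_zero.1 (norm_eq_zero.1 ?_))
    have hpar := parallelogram_law_with_norm ℝ (projAlong n (Φ x - c)) (projAlong n (Φ x₂ - c))
    have e1 : projAlong n (Φ x - c) + projAlong n (Φ x₂ - c) = ψ x - ψ y := by
      rw [hdx, hdx]; module
    have e2 : projAlong n (Φ x - c) - projAlong n (Φ x₂ - c) = ψ x - ψ x₂ := by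
      rw [hdx, hdx]; module
    rw [e1, e2] at hpar
    have h1 : ‖projAlong n (Φ x - c)‖ ≤ R / 2 := hxd
    have h2 : ‖projAlong n (Φ x₂ - c)‖ = R / 2 := hdx₂
    have h3 := hRmin x hx
    have h4 := norm_nonneg (ψ x - ψ x₂)
    have h5 := norm_nonneg (projAlong n (Φ x - c))
    rw [h2] at hpar
    nlinarith
  -- Steepness for which the barrier works wherever `R / 4 ≤ d x`.
  obtain ⟨β, hβ, hβ1, hβ2⟩ : ∃ β > 0, 3 ≤ β * (R / 4) ^ 2 ∧ K ≤ β * (R / 4) := by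
    have hR4 : 0 < R / 4 := by positivity
    refine ⟨3 / (R / 4) ^ 2 + K / (R / 4), by positivity, ?_, ?_⟩
    · rw [add_mul, div_mul_cancel₀ _ (by positivity)]
      have : 0 ≤ K / (R / 4) * (R / 4) ^ 2 := by positivity
      linarith
    · rw [add_mul, div_mul_cancel₀ K hR4.ne']
      have : 0 ≤ 3 / (R / 4) ^ 2 * (R / 4) := by positivity
      linarith
  have hGd : ∀ x, lineGaussian n c β (Φ x) = Real.exp (-β * d x ^ 2) := fun x => rfl
  -- On the region `N'` the gradient of the Gaussian is bounded below.
  set N' := N ∩ {x | R / 4 ≤ d x} with hN'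
  have hN'c : IsCompact N' := hNc.inter_right (isClosed_le continuous_const hdc)
  have hx₂N' : x₂ ∈ N' := ⟨hx₂A.1, by simp only [mem_ofPred_eq, hdx₂]; linarith⟩
  set T := N' ∩ ((interior N)ᶜ ∪ {x | d x ≤ R / 4}) with hT
  have hTc : IsCompact T := hN'c.inter_right
    (isOpen_interior.isClosed_compl.union (isClosed_le hdc continuous_const))
  have hx₂T : x₂ ∉ T := by
    rintro ⟨-, hx | hx⟩
    · exact hx hx₂int
    · simp only [mem_ofPred_eq, hdx₂] at hx
      linarith
  -- On the part of the boundary of `N'` inside the disc, `|Φ|²` is below its maximum by `ε`.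
  obtain ⟨ε, hε, hεT⟩ : ∃ ε > 0, ∀ x ∈ T, d x ≤ R / 2 → ‖Φ x‖ ^ 2 ≤ m - ε := by
    have hcpt : IsCompact (T ∩ {x | d x ≤ R / 2}) :=
      hTc.inter_right (isClosed_le hdc continuous_const)
    obtain hE | hE := (T ∩ {x | d x ≤ R / 2}).eq_empty_or_nonempty
    · refine ⟨1, one_pos, fun x hx hxd => ?_⟩
      have : x ∈ T ∩ {x | d x ≤ R / 2} := ⟨hx, hxd⟩
      simp [hE] at this
    · obtain ⟨z, hz, hzmax⟩ := hcpt.exists_isMaxOn hE (f := fun x => ‖Φ x‖ ^ 2) (by fun_prop)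
      refine ⟨m - ‖Φ z‖ ^ 2, sub_pos.2 (lt_of_le_of_ne (hm z) fun heq => ?_), fun x hx hxd => ?_⟩
      · exact hx₂T (hAd z ⟨hz.1.1.1, heq⟩ hz.2 ▸ hz.1)
      · have : ‖Φ x‖ ^ 2 ≤ ‖Φ z‖ ^ 2 := hzmax ⟨hx, hxd⟩
        linarith
  set w : M → ℝ := fun x => ‖Φ x‖ ^ 2 + ε * lineGaussian n c β (Φ x) with hw
  have hwc : Continuous w := by
    have : Continuous fun x => ε * Real.exp (-β * d x ^ 2) := by fun_prop
    exact (hΦc.norm.pow 2).add this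
  have hwx₂ : w x₂ = m + ε * Real.exp (-β * (R / 2) ^ 2) := by
    have : ‖Φ x₂‖ ^ 2 = m := hx₂A.2
    simp only [hw, hGd, hdx₂, this]
  have hwT : ∀ x ∈ T, w x < w x₂ := by
    intro x hx
    rw [hwx₂]
    simp only [hw, hGd]
    rcases le_or_gt (d x) (R / 2) with hxd | hxd
    · have h1 := hεT x hx hxd
      have h2 : Real.exp (-β * d x ^ 2) ≤ 1 := Real.exp_le_one_iff.2 (by nlinarith [sq_nonneg (d x)])
      have h3 := mul_pos hε (Real.exp_pos (-β * (R / 2) ^ 2))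
      nlinarith
    · have h1 : Real.exp (-β * d x ^ 2) < Real.exp (-β * (R / 2) ^ 2) := by
        refine Real.exp_lt_exp.2 ?_
        have : (R / 2) ^ 2 < d x ^ 2 := by gcongr
        nlinarith
      have h2 := mul_lt_mul_of_pos_left h1 hε
      linarith [hm x]
  obtain ⟨z, hzN', hzmax⟩ := hN'c.exists_isMaxOn ⟨x₂, hx₂N'⟩ hwc.continuousOn
  have hzT : z ∉ T := fun hz => (hwT z hz).not_ge (hzmax hx₂N')
  have hzint : z ∈ interior N := by
    by_contra hz
    exact hzT ⟨hzN', Or.inl hz⟩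
  have hzd : R / 4 < d z := by
    by_contra hz
    exact hzT ⟨hzN', Or.inr (not_lt.1 hz)⟩
  have hzloc : IsLocalMax w z := by
    filter_upwards [isOpen_interior.mem_nhds hzint, hdc.continuousAt.eventually (lt_mem_nhds hzd)]
      with t ht ht' using hzmax ⟨interior_subset ht, le_of_lt ht'⟩
  have hdz : d z = ‖projAlong n (Φ z - c)‖ := rfl
  refine h.not_isLocalMax_add_lineGaussian (hsub z) hn1 (hNsub hzN'.1).2 c hε hβ (hH z) ?_ ?_ hzloc
  · rw [← hdz]
    refine hβ1.trans ?_
    gcongr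
  · rw [← hdz]
    refine hβ2.trans ?_
    gcongr

end Surfaces

/-! ### Local homeomorphisms to the two-sphere -/

section Covering

variable {M : Type*} [TopologicalSpace M]

/-- A covering of the two-sphere has a section over the complement of a point, with a prescribed
value, because stereographic projection identifies this complement with a plane. -/
theorem IsCoveringMap.exists_section_compl_singleton {f : M → Metric.sphere (0 : E3) 1}
    (hf : IsCoveringMap f) {N : Metric.sphere (0 : E3) 1} {x : M} (hx : f x ≠ N) :
    ∃ s : Metric.sphere (0 : E3) 1 → M, ContinuousOn s {N}ᶜ ∧ (∀ q ≠ N, f (s q) = q) ∧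
      s (f x) = x := by
  have : Fact (Module.finrank ℝ E3 = 2 + 1) := ⟨finrank_euclideanSpace_fin⟩
  set e := stereographic' 2 N with he
  have hs : e.source = {N}ᶜ := stereographic'_source N
  have ht : e.target = univ := stereographic'_target N
  have hcont : Continuous e.symm := by
    rw [← continuousOn_univ, ← ht]
    exact e.continuousOn_symm
  have hleft : ∀ q ≠ N, e.symm (e q) = q := fun q hq => e.left_inv (by rw [hs]; exact hq)
  obtain ⟨F, ⟨hF0, hF⟩, -⟩ := hf.existsUnique_continuousMap_lifts ⟨e.symm, hcont⟩ (e (f x)) x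
    (hleft _ hx).symm
  refine ⟨fun q => F (e q), ?_, fun q hq => ?_, hF0⟩
  · rw [← hs]
    exact F.continuous.comp_continuousOn e.continuousOn
  · have : f (F (e q)) = e.symm (e q) := congrFun hF (e q)
    rw [this, hleft q hq]

/-- The complement of two points in the two-sphere is connected. -/
theorem isPreconnected_compl_pair_sphere {N₁ N₂ : Metric.sphere (0 : E3) 1} (hN : N₂ ≠ N₁) :
    IsPreconnected ({N₁}ᶜ ∩ {N₂}ᶜ : Set (Metric.sphere (0 : E3) 1)) := by
  have : Fact (Module.finrank ℝ E3 = 2 + 1) := ⟨finrank_euclideanSpace_fin⟩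
  set e := stereographic' 2 N₁ with he
  have hs : e.source = {N₁}ᶜ := stereographic'_source N₁
  have ht : e.target = univ := stereographic'_target N₁
  have himage : ({N₁}ᶜ ∩ {N₂}ᶜ : Set (Metric.sphere (0 : E3) 1)) = e.symm '' {e N₂}ᶜ := by
    ext q
    constructor
    · rintro ⟨h1, h2⟩
      refine ⟨e q, fun h => h2 (e.injOn (by rwa [hs]) (by rw [hs]; exact hN) h), ?_⟩
      exact e.left_inv (by rwa [hs])
    · rintro ⟨z, hz, rfl⟩
      have hz' : e.symm z ∈ e.source := e.map_target (by rw [ht]; trivial)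
      refine ⟨by rwa [hs] at hz', fun h => hz ?_⟩
      rw [mem_singleton_iff] at h ⊢
      rw [← h, e.right_inv (by rw [ht]; trivial)]
  rw [himage]
  refine IsPreconnected.image ?_ _ (e.continuousOn_symm.mono (by rw [ht]; exact subset_univ _))
  refine (isConnected_compl_singleton_of_one_lt_rank ?_ _).isPreconnected
  rw [← Module.finrank_eq_rank]
  simp

/-- A local homeomorphism from a compact connected Hausdorff space to the two-sphere is bijective.
It is a covering map; its sections over the complements of two points agree on the connected
intersection, so they define a global section, whose image is open and closed. -/
theorem IsLocalHomeomorph.bijective_of_sphere [T2Space M] [CompactSpace M] [ConnectedSpace M]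
    {f : M → Metric.sphere (0 : E3) 1} (hf : IsLocalHomeomorph f) : Function.Bijective f := by
  have hcov : IsCoveringMap f := isLocalHomeomorph_iff_isCoveringMap.1 hf
  obtain ⟨x⟩ : Nonempty M := inferInstance
  have : Fact (Module.finrank ℝ E3 = 2 + 1) := ⟨finrank_euclideanSpace_fin⟩
  set e := stereographic' 2 (f x) with he
  have hs : e.source = {f x}ᶜ := stereographic'_source _
  have ht : e.target = univ := stereographic'_target _
  have hne : ∀ z, e.symm z ≠ f x := fun z => by
    have : e.symm z ∈ e.source := e.map_target (by rw [ht]; trivial)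
    rwa [hs] at this
  set N₁ := e.symm 0 with hN₁
  set N₂ := e.symm (EuclideanSpace.single 0 1) with hN₂
  have hN : N₂ ≠ N₁ := fun h => by
    have := e.symm.injOn (by simp [ht]) (by simp [ht]) h
    simp at this
  obtain ⟨s₁, hc₁, hs₁, hx₁⟩ := hcov.exists_section_compl_singleton (hne 0).symm
  obtain ⟨s₂, hc₂, hs₂, hx₂⟩ :=
    hcov.exists_section_compl_singleton (hne (EuclideanSpace.single 0 1)).symm
  have hagree : EqOn s₁ s₂ ({N₁}ᶜ ∩ {N₂}ᶜ) := by
    refine hcov.eqOn_of_comp_eqOn (isPreconnected_compl_pair_sphere hN)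
      (hc₁.mono inter_subset_left) (hc₂.mono inter_subset_right) ?_
      (a := f x) ⟨(hne _).symm, (hne _).symm⟩ (hx₁.trans hx₂.symm)
    rintro q ⟨h1, h2⟩
    exact (hs₁ q h1).trans (hs₂ q h2).symm
  classical
  set s : Metric.sphere (0 : E3) 1 → M := fun q => if q = N₁ then s₂ q else s₁ q with hsdef
  have hfs : ∀ q, f (s q) = q := by
    intro q
    by_cases hq : q = N₁
    · simp only [hsdef, if_pos hq]
      exact hs₂ q (hq ▸ hN.symm)
    · simp only [hsdef, if_neg hq]
      exact hs₁ q hq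
  have hsc : Continuous s := by
    refine continuous_iff_continuousAt.2 fun q => ?_
    by_cases hq : q = N₁
    · have hq2 : ({N₂}ᶜ : Set (Metric.sphere (0 : E3) 1)) ∈ 𝓝 q :=
        isOpen_compl_singleton.mem_nhds (hq ▸ hN.symm)
      refine (hc₂.continuousAt hq2).congr ?_
      filter_upwards [hq2] with t ht2
      by_cases ht1 : t = N₁
      · simp [hsdef, ht1]
      · simp only [hsdef, if_neg ht1]
        exact (hagree ⟨ht1, ht2⟩).symm
    · have hq1 : ({N₁}ᶜ : Set (Metric.sphere (0 : E3) 1)) ∈ 𝓝 q :=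
        isOpen_compl_singleton.mem_nhds hq
      refine (hc₁.continuousAt hq1).congr ?_
      filter_upwards [hq1] with t ht1
      simp only [hsdef, if_neg (show t ≠ N₁ from ht1)]
  have hid : f ∘ s = id := funext hfs
  have hopen : IsOpen (range s) :=
    (hf.isOpenEmbedding_of_comp (by rw [hid]; exact IsOpenEmbedding.id) hsc).isOpen_range
  have hclosed : IsClosed (range s) := (isCompact_range hsc).isClosed
  have hrange : range s = univ :=
    IsClopen.eq_univ ⟨hclosed, hopen⟩ ⟨_, mem_range_self (f x)⟩
  refine ⟨fun a b hab => ?_, fun q => ⟨s q, hfs q⟩⟩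
  obtain ⟨a', rfl⟩ := (hrange ▸ mem_univ a : a ∈ range s)
  obtain ⟨b', rfl⟩ := (hrange ▸ mem_univ b : b ∈ range s)
  rw [hfs, hfs] at hab
  rw [hab]

end Covering

/-! ### Immersions into a sphere -/

/-- Two unit vectors in an open hemisphere agree if they have the same projection to the equatorial
plane. -/
theorem eq_of_projAlong_eq {n p q : E3} (hp : ‖p‖ = 1) (hq : ‖q‖ = 1)
    (hnp : 0 < inner ℝ n p) (hnq : 0 < inner ℝ n q)
    (h : projAlong n p = projAlong n q) : p = q := by
  rw [projAlong_apply, projAlong_apply] at h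
  obtain ⟨t, ht⟩ : ∃ t : ℝ, q = p + t • n :=
    ⟨inner ℝ n q - inner ℝ n p, by
      rw [sub_eq_sub_iff_add_eq_add] at h
      rw [sub_smul, ← add_sub_assoc, h]
      abel⟩
  have h1 : ‖q‖ ^ 2 = ‖p‖ ^ 2 + t * (inner ℝ n p + inner ℝ n q) := by
    rw [ht, inner_add_right, inner_smul_right, norm_add_sq_real, inner_smul_right, norm_smul,
      mul_pow, real_inner_comm, real_inner_self_eq_norm_sq, Real.norm_eq_abs, sq_abs]
    ring
  rw [hp, hq] at h1
  have h2 : t = 0 := by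
    have : t * (inner ℝ n p + inner ℝ n q) = 0 := by linarith
    exact (mul_eq_zero.1 this).resolve_right (by positivity)
  rw [ht, h2, zero_smul, add_zero]

section Surfaces

variable {M : Type*} [TopologicalSpace M] [ChartedSpace (EuclideanSpace ℝ (Fin 2)) M]
  [IsManifold (𝓡 2) ∞ M] {Φ ν : M → E3}

/-- An immersion of a surface with values in the sphere of radius `r` is a local homeomorphism to
this sphere, here rescaled to the unit sphere. -/
theorem IsOrientedImmersion.isLocalHomeomorph_sphere (h : IsOrientedImmersion Φ ν) {r : ℝ}
    (hr : 0 < r) (hΦ : ∀ x, ‖Φ x‖ = r) {f : M → Metric.sphere (0 : E3) 1}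
    (hf : ∀ x, (f x : E3) = r⁻¹ • Φ x) : IsLocalHomeomorph f := by
  have hΦf : ∀ x, Φ x = r • (f x : E3) := fun x => by rw [hf, smul_inv_smul₀ hr.ne']
  have hcont : Continuous f := by
    rw [continuous_induced_rng]
    have : Continuous fun x => r⁻¹ • Φ x := by
      have := h.smooth.continuous
      fun_prop
    convert this using 2 with x
    exact hf x
  have hopen : IsOpenMap f := by
    refine IsOpenMap.of_nhds_le fun x V hV => ?_
    rw [Filter.mem_map] at hV
    obtain ⟨hpos, -⟩ := h.meanCurvature_of_isLocalMax (x := x)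
      (Eventually.of_forall fun y => by simp [hΦ])
    obtain ⟨θ, hθ, hid⟩ := h.exists_tangentCoord x
    have hloc := (h.tangentCoord_local x hid).2
    set S := {y | 0 < inner ℝ (f x : E3) (f y : E3)} with hS
    have hnorm : ∀ q : Metric.sphere (0 : E3) 1, ‖(q : E3)‖ = 1 := fun q => by
      simp
    have hSx : S ∈ 𝓝 x := by
      have : Continuous fun y => inner ℝ (f x : E3) (f y : E3) := by fun_prop
      exact this.continuousAt.eventually (lt_mem_nhds (by simp [hnorm]))
    -- The tangential coordinate of the image of a neighbourhood of `x` is a neighbourhood.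
    have himg := hloc (image_mem_map (inter_mem hV hSx))
    have hcq : Tendsto (fun q : Metric.sphere (0 : E3) 1 => θ (r • (q : E3))) (𝓝 (f x))
        (𝓝 (θ (Φ x))) := by
      rw [hΦf x]
      have : Continuous fun q : Metric.sphere (0 : E3) 1 => θ (r • (q : E3)) := by fun_prop
      exact this.tendsto (f x)
    have hSq : ∀ᶠ q : Metric.sphere (0 : E3) 1 in 𝓝 (f x), 0 < inner ℝ (f x : E3) (q : E3) := by
      have : Continuous fun q : Metric.sphere (0 : E3) 1 => inner ℝ (f x : E3) (q : E3) := by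
        fun_prop
      exact this.continuousAt.eventually (lt_mem_nhds (by simp [hnorm]))
    filter_upwards [hcq himg, hSq] with q hq hq0
    obtain ⟨y, ⟨hyV, hyS⟩, hy⟩ := hq
    have hproj : projAlong (ν x) (f y : E3) = projAlong (ν x) (q : E3) := by
      have h1 := congrArg (differential Φ x) hy
      simp only [hθ, hΦf y, map_smul] at h1
      exact smul_right_injective E3 hr.ne' h1
    -- The unit normal is `± f x`, and the projection along it does not depend on the sign.
    have hν : projAlong (f x : E3) = projAlong (ν x) := by
      have h2 : inner ℝ (ν x) (Φ x) ^ 2 = r ^ 2 := by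
        have := congrArg norm hpos
        rw [norm_smul, h.norm_normal x, mul_one, hΦ, Real.norm_eq_abs] at this
        rw [this, sq_abs]
      ext1 w
      rw [projAlong_apply, projAlong_apply, hf x, hpos]
      simp only [smul_smul, real_inner_smul_left]
      congr 2
      field_simp
      rw [h2]
    have hyq : f y = q := Subtype.ext
      (eq_of_projAlong_eq (hnorm _) (hnorm _) hyS hq0 (by rw [hν]; exact hproj))
    exact hyq ▸ hyV
  refine isLocalHomeomorph_iff_isOpenEmbedding_restrict.2 fun x => ?_
  obtain ⟨U, hU, hinj⟩ := h.injOn_projAlong x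
  refine ⟨interior U, isOpen_interior.mem_nhds (mem_interior_iff_mem_nhds.2 hU), ?_⟩
  refine .of_continuous_injective_isOpenMap (hcont.comp continuous_subtype_val) ?_
    (hopen.comp isOpen_interior.isOpenMap_subtype_val)
  rintro ⟨a, ha⟩ ⟨b, hb⟩ hab
  have hab' : f a = f b := hab
  refine Subtype.ext (hinj (interior_subset ha) (interior_subset hb) ?_)
  simp only [hΦf, hab']

end Surfaces

/-! ### Closed stationary surfaces -/

section Surfaces

variable {M : Type*} [TopologicalSpace M] [ChartedSpace (EuclideanSpace ℝ (Fin 2)) M]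
  {Φ ν : M → E3}

/-- At a point where the position vector is normal, an `α`-stationary surface has
`H ⟨ν, Φ⟩ = α`. -/
theorem IsAlphaStationary.meanCurvature_mul_of_normal {α : ℝ} (hs : IsAlphaStationary α Φ ν)
    (h : IsOrientedImmersion Φ ν) {x : M} (hx : Φ x = inner ℝ (ν x) (Φ x) • ν x) :
    meanCurvature Φ ν x * inner ℝ (ν x) (Φ x) = α := by
  have h1 : ‖Φ x‖ ^ 2 = inner ℝ (ν x) (Φ x) ^ 2 := by
    have := congrArg norm hx
    rw [norm_smul, h.norm_normal x, mul_one, Real.norm_eq_abs] at this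
    rw [this, sq_abs]
  have h2 : ‖Φ x‖ ^ 2 ≠ 0 := pow_ne_zero 2 (norm_ne_zero_iff.2 (hs.ne_zero x))
  rw [hs.eq x, div_mul_eq_mul_div, div_eq_iff h2, h1]
  ring

variable [IsManifold (𝓡 2) ∞ M]

/-- For a surface in a sphere centred at the origin, `H = -2 ⟨ν, Φ⟩ / |Φ|²`, because the function
`|Φ|²` has both a local maximum and a local minimum at every point. -/
theorem IsOrientedImmersion.meanCurvature_of_norm_eq (h : IsOrientedImmersion Φ ν) {r : ℝ}
    (hr : 0 < r) (hΦ : ∀ x, ‖Φ x‖ = r) (x : M) :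
    inner ℝ (ν x) (Φ x) ^ 2 = r ^ 2 ∧
      meanCurvature Φ ν x = -2 * inner ℝ (ν x) (Φ x) / ‖Φ x‖ ^ 2 := by
  obtain ⟨hpos, h1⟩ := h.meanCurvature_of_isLocalMax (x := x)
    (Eventually.of_forall fun y => by simp [hΦ])
  obtain ⟨-, h2⟩ := h.meanCurvature_of_isLocalMin (x := x)
    (Eventually.of_forall fun y => by simp [hΦ])
  have h3 : inner ℝ (ν x) (Φ x) ^ 2 = r ^ 2 := by
    have := congrArg norm hpos
    rw [norm_smul, h.norm_normal x, mul_one, hΦ, Real.norm_eq_abs] at this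
    rw [this, sq_abs]
  refine ⟨h3, ?_⟩
  rw [hΦ, eq_div_iff (by positivity), ← h3]
  linear_combination inner ℝ (ν x) (Φ x) * (le_antisymm h1 h2)

/-- A surface in a sphere centred at the origin is `α`-stationary only for `α = -2`. -/
theorem IsOrientedImmersion.isAlphaStationary_iff_of_norm_eq [Nonempty M]
    (h : IsOrientedImmersion Φ ν) {r : ℝ} (hr : 0 < r) (hΦ : ∀ x, ‖Φ x‖ = r) (α : ℝ) :
    IsAlphaStationary α Φ ν ↔ α = -2 := by
  constructor
  · intro hs
    obtain ⟨x⟩ : Nonempty M := inferInstance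
    obtain ⟨h1, h2⟩ := h.meanCurvature_of_norm_eq hr hΦ x
    have hne : inner ℝ (ν x) (Φ x) ≠ 0 := fun h0 => by
      rw [h0] at h1
      exact (pow_pos hr 2).ne (by simpa using h1)
    have h3 := (hs.eq x).symm.trans h2
    rw [hΦ, div_left_inj' (pow_pos hr 2).ne'] at h3
    exact mul_right_cancel₀ hne h3
  · rintro rfl
    exact ⟨fun x hx => hr.ne' (by rw [← hΦ x, hx, norm_zero]),
      fun x => (h.meanCurvature_of_norm_eq hr hΦ x).2⟩

/-- Comparison with the centred spheres that touch a closed stationary surface from outside and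
from inside. -/
theorem IsAlphaStationary.eq_neg_two [CompactSpace M] [Nonempty M] {α : ℝ}
    (hs : IsAlphaStationary α Φ ν) (h : IsOrientedImmersion Φ ν) : α = -2 := by
  have hc : Continuous fun x => ‖Φ x‖ ^ 2 := h.smooth.continuous.norm.pow 2
  obtain ⟨x, -, hx⟩ := isCompact_univ.exists_isMaxOn univ_nonempty hc.continuousOn
  obtain ⟨y, -, hy⟩ := isCompact_univ.exists_isMinOn univ_nonempty hc.continuousOn
  obtain ⟨h1, h2⟩ := h.meanCurvature_of_isLocalMax (hx.isLocalMax univ_mem)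
  obtain ⟨h3, h4⟩ := h.meanCurvature_of_isLocalMin (hy.isLocalMin univ_mem)
  rw [hs.meanCurvature_mul_of_normal h h1] at h2
  rw [hs.meanCurvature_mul_of_normal h h3] at h4
  linarith

/-- A closed connected `(-2)`-stationary surface lies in a centred sphere, by the strong maximum
principle: `|Φ|²` is subharmonic because `2 + H ⟨ν, Φ⟩ = 2 (1 - ⟨ν, Φ⟩² / |Φ|²)`. -/
theorem IsAlphaStationary.exists_norm_eq [T2Space M] [CompactSpace M] [ConnectedSpace M]
    (hs : IsAlphaStationary (-2) Φ ν) (h : IsOrientedImmersion Φ ν) :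
    ∃ r, 0 < r ∧ ∀ x, ‖Φ x‖ = r := by
  have hΦc : Continuous Φ := h.smooth.continuous
  have hc : Continuous fun x => ‖Φ x‖ ^ 2 := hΦc.norm.pow 2
  obtain ⟨x, -, hx⟩ := isCompact_univ.exists_isMaxOn univ_nonempty hc.continuousOn
  obtain ⟨y, -, hy⟩ := isCompact_univ.exists_isMinOn univ_nonempty hΦc.norm.continuousOn
  have hpos : ∀ z, 0 < ‖Φ z‖ := fun z => norm_pos_iff.2 (hs.ne_zero z)
  have hin : ∀ z, |inner ℝ (ν z) (Φ z)| ≤ ‖Φ z‖ := fun z => by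
    simpa [h.norm_normal z] using abs_real_inner_le_norm (ν z) (Φ z)
  have hsub : ∀ z, 0 ≤ 2 + meanCurvature Φ ν z * inner ℝ (ν z) (Φ z) := fun z => by
    have h1 : inner ℝ (ν z) (Φ z) ^ 2 / ‖Φ z‖ ^ 2 ≤ 1 :=
      div_le_one_of_le₀ (sq_le_sq' (abs_le.1 (hin z)).1 (abs_le.1 (hin z)).2) (by positivity)
    have h2 : meanCurvature Φ ν z * inner ℝ (ν z) (Φ z) =
        -2 * (inner ℝ (ν z) (Φ z) ^ 2 / ‖Φ z‖ ^ 2) := by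
      rw [hs.eq z]; ring
    linarith
  have hH : ∀ z, |meanCurvature Φ ν z| ≤ 2 / ‖Φ y‖ := fun z => by
    rw [hs.eq z, abs_div, abs_mul, abs_neg, abs_two, abs_of_pos (pow_pos (hpos z) 2)]
    calc 2 * |inner ℝ (ν z) (Φ z)| / ‖Φ z‖ ^ 2 ≤ 2 * ‖Φ z‖ / ‖Φ z‖ ^ 2 := by
          gcongr
          exact hin z
      _ = 2 / ‖Φ z‖ := by have := (hpos z).ne'; field_simp
      _ ≤ 2 / ‖Φ y‖ := div_le_div_of_nonneg_left zero_le_two (hpos y) (hy (mem_univ z))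
  have hm : ∀ z, ‖Φ z‖ ^ 2 ≤ ‖Φ x‖ ^ 2 := fun z => hx (mem_univ z)
  have hopen : IsOpen {z | ‖Φ z‖ ^ 2 = ‖Φ x‖ ^ 2} := isOpen_iff_mem_nhds.2 fun z hz =>
    h.eventually_norm_sq_eq hsub (div_nonneg zero_le_two (hpos y).le) hH hm hz
  have huniv := IsClopen.eq_univ ⟨isClosed_eq hc continuous_const, hopen⟩ ⟨x, rfl⟩
  refine ⟨‖Φ x‖, hpos x, fun z => ?_⟩
  have hz : ‖Φ z‖ ^ 2 = ‖Φ x‖ ^ 2 := by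
    have := mem_univ z
    rwa [← huniv] at this
  exact (pow_left_inj₀ (norm_nonneg _) (norm_nonneg _) two_ne_zero).1 hz

/-- A closed connected surface immersed in a sphere is embedded, with image the whole sphere. -/
theorem IsOrientedImmersion.injective_and_range_of_norm_eq [T2Space M] [CompactSpace M]
    [ConnectedSpace M] (h : IsOrientedImmersion Φ ν) {r : ℝ} (hr : 0 < r)
    (hΦ : ∀ x, ‖Φ x‖ = r) : Function.Injective Φ ∧ range Φ = Metric.sphere (0 : E3) r := by
  have hmem : ∀ x, r⁻¹ • Φ x ∈ Metric.sphere (0 : E3) 1 := fun x => by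
    simp [norm_smul, hΦ, abs_of_pos hr, hr.ne']
  obtain ⟨hinj, hsurj⟩ := (h.isLocalHomeomorph_sphere hr hΦ
    (f := fun x => ⟨r⁻¹ • Φ x, hmem x⟩) fun x => rfl).bijective_of_sphere
  refine ⟨fun a b hab => hinj (Subtype.ext (congrArg (r⁻¹ • ·) hab)), ?_⟩
  refine Subset.antisymm (range_subset_iff.2 fun x => by simp [hΦ]) fun q hq => ?_
  have hq' : ‖q‖ = r := by simpa using hq
  obtain ⟨x, hx⟩ := hsurj ⟨r⁻¹ • q, by simp [norm_smul, hq', abs_of_pos hr, hr.ne']⟩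
  exact ⟨x, smul_right_injective E3 (inv_ne_zero hr.ne') (congrArg Subtype.val hx)⟩

end Surfaces

/-! ### Round spheres -/

theorem norm_roundSphere {r : ℝ} (hr : 0 < r) (p : Metric.sphere (0 : E3) 1) :
    ‖roundSphere r p‖ = r := by
  simp [roundSphere, norm_smul, abs_of_pos hr]

theorem isOrientedImmersion_roundSphere {r : ℝ} (hr : 0 < r) :
    IsOrientedImmersion (roundSphere r) roundSphereNormal := by
  have : Fact (Module.finrank ℝ E3 = 2 + 1) := ⟨finrank_euclideanSpace_fin⟩
  set ι : Metric.sphere (0 : E3) 1 → E3 := Subtype.val with hι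
  have hcoe : ContMDiff (𝓡 2) 𝓘(ℝ, E3) ∞ ι := contMDiff_coe_sphere
  have hsm : ContMDiff (𝓡 2) 𝓘(ℝ, E3) ∞ (roundSphere r) :=
    (contDiff_const_smul r).contMDiff.comp hcoe
  have hdι : ∀ p, HasFDerivAt (inChart ι p) (differential ι p) (extChartAt (𝓡 2) p p) := fun p =>
    hasFDerivAt_inChart (hcoe.mdifferentiable (by simp) p)
  have hd : ∀ p, differential (roundSphere r) p = r • differential ι p := fun p =>
    (hasFDerivAt_inChart (hsm.mdifferentiable (by simp) p)).unique ((hdι p).const_smul r)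
  have horth : ∀ (p : Metric.sphere (0 : E3) 1) v, inner ℝ (p : E3) (differential ι p v) = 0 := by
    intro p v
    have h1 := (hdι p).norm_sq
    have h2 : (fun y => ‖inChart ι p y‖ ^ 2) = fun _ => 1 := by
      ext y
      simp [inChart, hι]
    rw [h2] at h1
    have h3 := DFunLike.congr_fun (h1.unique (hasFDerivAt_const (1 : ℝ) _)) v
    have h4 : inner ℝ (inChart ι p (extChartAt (𝓡 2) p p)) (differential ι p v) = 0 := by
      simpa using h3
    rwa [inChart_self] at h4
  refine ⟨hsm, fun p => ?_, contDiff_neg.contMDiff.comp hcoe, fun p => ?_, fun p v => ?_⟩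
  · have hinj : Function.Injective (differential ι p) := injective_mvfderiv_subtypeVal_sphere p
    change Function.Injective (differential (roundSphere r) p)
    rw [hd]
    exact (smul_right_injective E3 hr.ne').comp hinj
  · simp [roundSphereNormal]
  · let w : EuclideanSpace ℝ (Fin 2) := v
    change inner ℝ (-(p : E3)) (differential (roundSphere r) p w) = 0
    rw [hd, smul_apply, inner_smul_right, inner_neg_left, horth, neg_zero, mul_zero]

end

theorem theorem2p6 (α : ℝ) :
    (∀ (M : Type*) [TopologicalSpace M] [ChartedSpace (EuclideanSpace ℝ (Fin 2)) M]
        [IsManifold (𝓡 2) ∞ M] [T2Space M] [CompactSpace M] [ConnectedSpace M]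
        (Φ ν : M → E3), IsOrientedImmersion Φ ν →
        (IsAlphaStationary α Φ ν ↔
          α = -2 ∧ ∃ r : ℝ, 0 < r ∧ Function.Injective Φ ∧
            Set.range Φ = Metric.sphere (0 : E3) r)) ∧
      ∀ r : ℝ, 0 < r →
        IsOrientedImmersion (roundSphere r) roundSphereNormal ∧
          (IsAlphaStationary α (roundSphere r) roundSphereNormal ↔ α = -2) := by
  refine ⟨fun M _ _ _ _ _ _ Φ ν h => ⟨fun hs => ?_, ?_⟩, fun r hr => ?_⟩
  · obtain rfl := hs.eq_neg_two h
    obtain ⟨r, hr, hΦ⟩ := hs.exists_norm_eq h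
    exact ⟨rfl, r, hr, h.injective_and_range_of_norm_eq hr hΦ⟩
  · rintro ⟨hα, r, hr, -, hrange⟩
    have hΦ : ∀ x, ‖Φ x‖ = r := fun x => by
      have : Φ x ∈ Metric.sphere (0 : E3) r := hrange ▸ Set.mem_range_self x
      simpa using this
    exact (h.isAlphaStationary_iff_of_norm_eq hr hΦ α).2 hα
  · have : Nonempty (Metric.sphere (0 : E3) 1) :=
      (NormedSpace.sphere_nonempty.2 zero_le_one).to_subtype
    have h := isOrientedImmersion_roundSphere hr
    exact ⟨h, h.isAlphaStationary_iff_of_norm_eq hr (norm_roundSphere hr) α⟩
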